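/- Let $G$ be a finite simple graph. An edge $\{i,j\}$ of $G$ is a *right edge* if, whenever $\{i,i'\}$ and $\{j,j'\}$ are edges of $G$, $\{i',j'\}$ is also an edge of $G$. The graph $G$ satisfies the *weak square condition* (WSC) if every vertex of $G$ lies on a right edge. Let $G^{0-1}$ be the graph with the same vertices as $G$ whose edges are the right edges of $G$; each of its connected components is an isolated vertex or a complete bipartite graph with both sides nonempty. The *projected graph* $\pi(G)$ has as vertices the two sides $A$, $B$ of the bipartition of each complete bipartite component of $G^{0-1}$ and the sets $\{v\}$ for $v$ an isolated vertex of $G^{0-1}$; two vertices $U,W$ of $\pi(G)$ are adjacent if and only if some edge of $G$ connects a vertex of $U$ with a vertex of $W$. For a field $K$ and a finite simple graph $H$, let $I(H)=(x_ix_j : \{i,j\}\in E(H))\subseteq K[x_v : v\in V(H)]$ be the edge ideal and let $\Delta(I(H))$ be the simplicial complex whose faces are the sets $\{i_1,\dots,i_s\}$ of vertices with $x_{i_1}\cdots x_{i_s}\notin I(H)$, i.e. the independence complex of $H$. **Theorem 4.7.** Suppose that $G$ satisfies the WSC. Then $\Delta(I(\pi(G)))$ is shellable, that is, all its facets have the same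 dimension and they can be ordered $F_1,\dots,F_m$ in such a way that for all $1\le j<i\le m$ there are $v\in F_i\setminus F_j$ and $k<i$ with $F_i\setminus F_k=\{v\}$. In particular $\pi(G)$ is a Cohen–Macaulay graph: for every field $K$ the ring $K[x_U : U\in V(\pi(G))]/I(\pi(G))$ is Cohen–Macaulay. -/

import Mathlib

/-! ## Right edges, the weak square condition, and the projected graph -/

namespace SimpleGraph

variable {V : Type*}

/-- `{i, j}` is a right edge of `G`: it is an edge, and whenever `{i, i'}` and `{j, j'}` are edges
of `G`, so is `{i', j'}` (in particular `i' ≠ j'`). -/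
def IsRightEdge (G : SimpleGraph V) (i j : V) : Prop :=
  G.Adj i j ∧ ∀ i' j', G.Adj i i' → G.Adj j j' → G.Adj i' j'

/-- The weak square condition: every vertex `v` lies on an edge `{v, w}` such that
`{v, v'} ∈ E` and `{w, w'} ∈ E` imply `{v', w'} ∈ E`. -/
def WeakSquareCondition (G : SimpleGraph V) : Prop :=
  ∀ v, ∃ w, G.Adj v w ∧ ∀ v' w', G.Adj v v' → G.Adj w w' → G.Adj v' w'

/-- The graph `G^{0-1}`: same vertices as `G`, and its edges are the right edges of `G`. -/
def zeroOneGraph (G : SimpleGraph V) : SimpleGraph V where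
  Adj i j := G.IsRightEdge i j
  symm := ⟨fun _ _ h => ⟨h.1.symm, fun i' j' hi hj => (h.2 j' i' hj hi).symm⟩⟩
  loopless := ⟨fun i h => G.loopless.irrefl i h.1⟩

/-- The subgraph of `H` induced on `S` is a complete bipartite graph (with both sides nonempty)
with bipartition `(A, B)`. -/
structure IsCompleteBipartiteOn (H : SimpleGraph V) (S A B : Set V) : Prop where
  left_nonempty : A.Nonempty
  right_nonempty : B.Nonempty
  disjoint : Disjoint A B
  union_eq : A ∪ B = S
  adj_iff : ∀ x ∈ S, ∀ y ∈ S, H.Adj x y ↔ (x ∈ A ∧ y ∈ B) ∨ (x ∈ B ∧ y ∈ A)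

/-- `U` is a vertex of the projected graph: either `U = {v}` for an isolated vertex `v` of
`G^{0-1}`, or `U` is one of the two sides of the bipartition of a connected component of `G^{0-1}`
that is a complete bipartite graph. (Both sides `A`, `B` of a component arise, because
`IsCompleteBipartiteOn` is symmetric in them.) -/
def IsProjVertex (G : SimpleGraph V) (U : Set V) : Prop :=
  (∃ v, (∀ w, ¬ G.zeroOneGraph.Adj v w) ∧ U = {v}) ∨
  (∃ (C : G.zeroOneGraph.ConnectedComponent) (W : Set V),
    G.zeroOneGraph.IsCompleteBipartiteOn C.supp U W)

/-- The vertex set of the projected graph `π(G)`. -/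
abbrev ProjVertex (G : SimpleGraph V) : Type _ := {U : Set V // G.IsProjVertex U}

/-- There is no edge of `G` inside a vertex of the projected graph. -/
theorem IsProjVertex.not_adj {G : SimpleGraph V} {U : Set V} (hU : G.IsProjVertex U)
    {u u' : V} (hu : u ∈ U) (hu' : u' ∈ U) : ¬ G.Adj u u' := by
  intro h
  rcases hU with ⟨v, -, rfl⟩ | ⟨C, W, hC⟩
  · rw [Set.mem_singleton_iff] at hu hu'
    subst hu hu'
    exact G.loopless.irrefl _ h
  · obtain ⟨w, hw⟩ := hC.right_nonempty
    have huS : u ∈ C.supp := hC.union_eq ▸ Or.inl hu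
    have huS' : u' ∈ C.supp := hC.union_eq ▸ Or.inl hu'
    have hwS : w ∈ C.supp := hC.union_eq ▸ Or.inr hw
    have h1 : G.IsRightEdge u w := (hC.adj_iff u huS w hwS).2 (Or.inl ⟨hu, hw⟩)
    have h2 : G.IsRightEdge u' w := (hC.adj_iff u' huS' w hwS).2 (Or.inl ⟨hu', hw⟩)
    exact G.loopless.irrefl _ (h1.2 u' u' h h2.1.symm)

/-- The projected graph `π(G)`: `U` and `W` are adjacent iff some edge of `G` connects a vertex of
`U` with a vertex of `W`. -/
def proj (G : SimpleGraph V) : SimpleGraph G.ProjVertex where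
  Adj U W := ∃ u ∈ U.1, ∃ w ∈ W.1, G.Adj u w
  symm := ⟨fun _ _ ⟨u, hu, w, hw, h⟩ => ⟨w, hw, u, hu, h.symm⟩⟩
  loopless := ⟨fun U ⟨_, hu, _, hu', h⟩ => U.2.not_adj hu hu' h⟩

/-- The edge ideal `I(G) = (x_i x_j : {i, j} ∈ E(G))` in the polynomial ring `K[x_v : v ∈ V]`. -/
noncomputable def edgeIdeal (G : SimpleGraph V) (K : Type*) [Field K] : Ideal (MvPolynomial V K) :=
  Ideal.span {p | ∃ i j, G.Adj i j ∧ p = MvPolynomial.X i * MvPolynomial.X j}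

end SimpleGraph

/-! ## Simplicial complexes of ideals and shellability -/

/-- The simplicial complex `Δ(I)`: a set of variables is a face iff the product of the variables is
not in `I`. (Following Mathlib's convention the empty face is not recorded.) -/
noncomputable def MvPolynomial.idealComplex {σ K : Type*} [Field K] (I : Ideal (MvPolynomial σ K)) :
    PreAbstractSimplicialComplex σ where
  faces := {s | s.Nonempty ∧ ∏ i ∈ s, (MvPolynomial.X i : MvPolynomial σ K) ∉ I}
  isRelLowerSet_faces := fun _ hs => ⟨hs.1, fun _ ht hne =>
    ⟨hne, fun h => hs.2 (I.mem_of_dvd (Finset.prod_dvd_prod_of_subset _ _ _ ht) h)⟩⟩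

namespace PreAbstractSimplicialComplex

variable {σ : Type*}

/-- Facets are the faces that are maximal under inclusion. -/
def IsFacet (Δ : PreAbstractSimplicialComplex σ) (F : Finset σ) : Prop :=
  F ∈ Δ ∧ ∀ F' ∈ Δ, F ⊆ F' → F = F'

/-- All facets have the same dimension. -/
def IsPure (Δ : PreAbstractSimplicialComplex σ) : Prop :=
  ∀ F F', Δ.IsFacet F → Δ.IsFacet F' → F.card = F'.card

/-- A (finite) simplicial complex is shellable if it is pure and its facets can be listed, without
repetition, as `F_1, …, F_m` so that for all `j < i` there are `v ∈ F_i \ F_j` and `k < i` with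
`F_i \ F_k = {v}`. -/
def IsShellable (Δ : PreAbstractSimplicialComplex σ) : Prop :=
  Δ.IsPure ∧ ∃ (m : ℕ) (F : Fin m → Finset σ), Function.Injective F ∧
    (∀ s, Δ.IsFacet s ↔ ∃ i, F i = s) ∧
    ∀ i j, j < i → ∃ v, v ∈ F i ∧ v ∉ F j ∧ ∃ k, k < i ∧ (F i : Set σ) \ (F k : Set σ) = {v}

end PreAbstractSimplicialComplex

/-! ## Cohen–Macaulay rings and graphs -/

/-- The depth of a (Noetherian) local ring: the supremum of the lengths of the regular sequences
contained in the maximal ideal. -/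
noncomputable def localRingDepth (R : Type*) [CommRing R] [IsLocalRing R] : ℕ∞ :=
  ⨆ rs ∈ {rs : List R | (∀ r ∈ rs, r ∈ IsLocalRing.maximalIdeal R) ∧
    RingTheory.Sequence.IsRegular R rs}, (rs.length : ℕ∞)

/-- A Cohen–Macaulay ring: Noetherian, and the localization at each maximal ideal has depth equal
to its Krull dimension. -/
def IsCohenMacaulayRing (R : Type*) [CommRing R] : Prop :=
  IsNoetherianRing R ∧ ∀ (m : Ideal R) [m.IsMaximal],
    (localRingDepth (Localization.AtPrime m) : WithBot ℕ∞) =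
      ringKrullDim (Localization.AtPrime m)

/-- `G` is Cohen–Macaulay over `K` if `K[x_v : v ∈ V] / I(G)` is a Cohen–Macaulay ring. -/
def SimpleGraph.IsCohenMacaulayOver {V : Type*} (G : SimpleGraph V) (K : Type*) [Field K] : Prop :=
  IsCohenMacaulayRing (MvPolynomial V K ⧸ G.edgeIdeal K)

/-! ### Cohen–Macaulayness of finite flat algebras over polynomial rings. -/

open RingTheory.Sequence

/-! Under the WSC, exchanging the two sides of each component of right edges is a perfect matching
`s` of `π(G)` by right edges, and there are no others (`exists_isRightPairing_proj`). Then "`x` is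
adjacent to `s y`" is a partial order, and facets are the independent sets with one vertex from each
pair; they are up-sets.

Fix a facet `F₀` and sort the facets by `|F \ F₀|`. For `F'` before `F`, a minimal `v` of `F \ (F' ∪
F₀)` is minimal in `F`, so replacing `v` by `s v` gives a facet, and an earlier one since `s v ∈ F₀`
(`exists_shelling`).

For Cohen–Macaulayness, the polynomial ring on the pairs acts through the sums `x_v + x_{s v}`.
Restrictions to facets are jointly injective and triangular on the monomials of vertices whose flip
is an earlier facet. So the quotient ring is free with one basis element per facet, and a finite
flat algebra over a polynomial ring over a field is Cohen–Macaulay. -/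

/-- The quotient is `(A/I)[X]`, where `f` stays monic. -/
theorem Polynomial.Monic.isSMulRegular_quotient_map_C {A : Type*} [CommRing A] (I : Ideal A)
    {f : Polynomial A} (hf : f.Monic) :
    IsSMulRegular (Polynomial A ⧸ I.map (Polynomial.C : A →+* Polynomial A)) f := by
  have key : ∀ g : Polynomial A, g ∈ I.map (Polynomial.C : A →+* Polynomial A) ↔
      g.map (Ideal.Quotient.mk I) = 0 := fun g => by
    rw [Ideal.mem_map_C_iff, Polynomial.ext_iff]
    simp [Ideal.Quotient.eq_zero_iff_mem]
  rw [isSMulRegular_iff_right_eq_zero_of_smul]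
  intro x hx
  obtain ⟨g, rfl⟩ := Ideal.Quotient.mk_surjective x
  have h : f * g ∈ I.map (Polynomial.C : A →+* Polynomial A) := by
    rw [← Ideal.Quotient.eq_zero_iff_mem]
    exact hx
  rw [key, Polynomial.map_mul, (hf.map _).mul_right_eq_zero_iff] at h
  rw [Ideal.Quotient.eq_zero_iff_mem, key]
  exact h

/-- Monic polynomials in the separate variables form a regular sequence. -/
theorem MvPolynomial.exists_isWeaklyRegular_aeval_X (K : Type*) [CommRing K] (n : ℕ)
    (f : Fin n → Polynomial K) (hf : ∀ i, (f i).Monic) :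
    ∃ rs : List (MvPolynomial (Fin n) K), rs.length = n ∧
      (∀ r ∈ rs, ∃ i, r = Polynomial.aeval (MvPolynomial.X i) (f i)) ∧
      IsWeaklyRegular (MvPolynomial (Fin n) K) rs := by
  induction n with
  | zero => exact ⟨[], rfl, by simp, IsWeaklyRegular.nil _ _⟩
  | succ n ih =>
    obtain ⟨rs, hl, hr, hreg⟩ := ih (fun i => f i.succ) (fun i => hf _)
    let A := MvPolynomial (Fin n) K
    let e := MvPolynomial.finSuccEquiv K n
    let g : Polynomial A := Polynomial.aeval Polynomial.X (f 0)
    have hg : g = (f 0).map (algebraMap K A) := by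
      exact ((Polynomial.aeval_map_algebraMap A _ _).symm.trans (Polynomial.aeval_X_left_apply _))
    -- Flatness of `A → A[X]` preserves regularity; the monic polynomial in the new variable comes
    -- last.
    have h1 : IsWeaklyRegular (Polynomial A) (rs.map (algebraMap A (Polynomial A))) :=
      hreg.of_flat
    have h2 : IsWeaklyRegular (Polynomial A) (rs.map (algebraMap A (Polynomial A)) ++ [g]) := by
      rw [isWeaklyRegular_append_iff, isWeaklyRegular_singleton_iff]
      refine ⟨h1, ?_⟩
      have : Ideal.ofList (rs.map (algebraMap A (Polynomial A))) • (⊤ : Ideal (Polynomial A)) =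
          (Ideal.ofList rs).map (Polynomial.C : A →+* Polynomial A) := by
        rw [Ideal.map_ofList]; simp [Polynomial.algebraMap_eq]
      rw [this]
      exact Polynomial.Monic.isSMulRegular_quotient_map_C _ (hg ▸ (hf 0).map _)
    have h3 := ((AddEquiv.isWeaklyRegular_congr (M := Polynomial A)
      (M₂ := MvPolynomial (Fin (n + 1)) K) (e := e.symm.toAddEquiv)
      (as := rs.map (algebraMap A (Polynomial A)) ++ [g])
      (bs := (rs.map (algebraMap A (Polynomial A)) ++ [g]).map e.symm) (by
        rw [List.forall₂_map_right_iff, List.forall₂_same]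
        intro r _ x
        exact map_mul e.symm r x))).1 h2
    have he : ∀ x (p : Polynomial K), e (Polynomial.aeval x p) = Polynomial.aeval (e x) p :=
      fun x p => (Polynomial.aeval_algHom_apply e x p).symm
    refine ⟨_, ?_, ?_, h3⟩
    · simp [hl]
    · intro r hr'
      rw [List.map_append, List.mem_append] at hr'
      rcases hr' with h | h
      · simp only [List.map_map, List.mem_map] at h
        obtain ⟨a, ha, rfl⟩ := h
        obtain ⟨i, rfl⟩ := hr a ha
        refine ⟨i.succ, ?_⟩
        apply e.injective
        simp only [Function.comp, AlgEquiv.apply_symm_apply]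
        rw [he, show e (X i.succ) = algebraMap A (Polynomial A) (X i) from
          MvPolynomial.finSuccEquiv_X_succ, Polynomial.aeval_algebraMap_apply]
      · simp only [List.map_cons, List.map_nil, List.mem_singleton] at h
        refine ⟨0, ?_⟩
        rw [h]
        apply e.injective
        simp only [AlgEquiv.apply_symm_apply, g]
        rw [he, show e (X 0) = Polynomial.X from MvPolynomial.finSuccEquiv_X_zero]

theorem localRingDepth_le_ringKrullDim (R : Type*) [CommRing R] [IsLocalRing R]
    [IsNoetherianRing R] : (localRingDepth R : WithBot ℕ∞) ≤ ringKrullDim R := by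
  obtain ⟨d, hd⟩ := WithBot.ne_bot_iff_exists.1 (ringKrullDim_ne_bot (R := R))
  rw [← hd, WithBot.coe_le_coe]
  refine iSup₂_le fun rs hrs => ?_
  have h := ringKrullDim_add_length_eq_ringKrullDim_of_isRegular rs hrs.2
  have hn : Nontrivial (R ⧸ Ideal.ofList rs) := by
    have := hrs.2.quot_ofList_smul_nontrivial (⊤ : Ideal R)
    simpa using this
  have h0 : (0 : WithBot ℕ∞) ≤ ringKrullDim (R ⧸ Ideal.ofList rs) := ringKrullDim_nonneg_of_nontrivial
  rw [← WithBot.coe_le_coe, hd, ← h]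
  calc ((rs.length : ℕ∞) : WithBot ℕ∞) = 0 + (rs.length : WithBot ℕ∞) := by simp
    _ ≤ _ := by gcongr

/-- Incomparability: strict inclusions of primes stay strict after contraction. -/
theorem ringKrullDim_le_of_isIntegral (A B : Type*) [CommRing A] [CommRing B] [Algebra A B]
    [Algebra.IsIntegral A B] : ringKrullDim B ≤ ringKrullDim A := by
  refine Order.krullDim_le_of_strictMono
    (fun p : PrimeSpectrum B => PrimeSpectrum.comap (algebraMap A B) p) ?_
  intro p q hpq
  obtain ⟨h1, x, hxq, hxp⟩ := SetLike.lt_iff_le_and_exists.1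
    (show p.asIdeal < q.asIdeal from hpq)
  exact Ideal.comap_lt_comap_of_integral_mem_sdiff h1 ⟨hxq, hxp⟩
    (Algebra.IsIntegral.isIntegral x)

/-- A finite flat algebra over a polynomial ring over a field is Cohen–Macaulay. -/
theorem isCohenMacaulayRing_of_finite_flat (K R : Type*) [Field K] [CommRing R] (n : ℕ)
    [Algebra (MvPolynomial (Fin n) K) R] [Module.Finite (MvPolynomial (Fin n) K) R]
    [Module.Flat (MvPolynomial (Fin n) K) R] : IsCohenMacaulayRing R := by
  have hN : IsNoetherianRing R := IsNoetherianRing.of_finite (MvPolynomial (Fin n) K) R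
  refine ⟨hN, fun m hm => le_antisymm (localRingDepth_le_ringKrullDim _) ?_⟩
  have hdim : ringKrullDim (Localization.AtPrime m) ≤ n := by
    rw [IsLocalization.AtPrime.ringKrullDim_eq_height m]
    refine (Ideal.height_le_ringKrullDim_of_ne_top hm.ne_top).trans ?_
    refine (ringKrullDim_le_of_isIntegral (MvPolynomial (Fin n) K) R).trans ?_
    simp
  refine hdim.trans ?_
  let S := MvPolynomial (Fin n) K
  let : Algebra K R := ((algebraMap S R).comp (algebraMap K S)).toAlgebra
  have : IsScalarTower K S R := IsScalarTower.of_algebraMap_eq fun _ => rfl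
  have : Algebra.FiniteType K R :=
    Algebra.FiniteType.trans (S := S) inferInstance inferInstance
  let : Field (R ⧸ m) := Ideal.Quotient.field m
  have : Algebra.FiniteType K (R ⧸ m) :=
    Algebra.FiniteType.trans (S := R) inferInstance inferInstance
  -- Zariski's lemma: each coordinate is algebraic over `K` modulo `m`, so the minimal polynomials
  -- below give `n` elements of `m`.
  have : Module.Finite K (R ⧸ m) := finite_of_finite_type_of_isJacobsonRing K (R ⧸ m)
  let θ : Fin n → R := fun i => algebraMap S R (MvPolynomial.X i)
  let f : Fin n → Polynomial K := fun i => minpoly K (Ideal.Quotient.mk m (θ i))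
  obtain ⟨rs, hl, hrs, hreg⟩ := MvPolynomial.exists_isWeaklyRegular_aeval_X K n f
    (fun i => minpoly.monic (Algebra.IsIntegral.isIntegral _))
  have hmem : ∀ r ∈ rs.map (algebraMap S R), r ∈ m := by
    intro r hr
    obtain ⟨a, ha, rfl⟩ := List.mem_map.1 hr
    obtain ⟨i, rfl⟩ := hrs a ha
    rw [← Ideal.Quotient.eq_zero_iff_mem]
    have := minpoly.aeval K (Ideal.Quotient.mk m (θ i))
    rw [← Polynomial.aeval_algebraMap_apply]
    rw [← Ideal.Quotient.algebraMap_eq, ← Polynomial.aeval_algebraMap_apply]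
    exact this
  have h1 : IsWeaklyRegular R (rs.map (algebraMap S R)) := hreg.of_flat
  have h2 := h1.isRegular_of_isLocalization_of_mem (Localization.AtPrime m) m hmem
  have h3 : (n : ℕ∞) ≤ localRingDepth (Localization.AtPrime m) := by
    unfold localRingDepth
    refine le_iSup₂_of_le _ ⟨?_, h2⟩ ?_
    · intro r hr
      obtain ⟨a, ha, rfl⟩ := List.mem_map.1 hr
      exact (IsLocalization.AtPrime.to_map_mem_maximal_iff _ m a).2 (hmem a ha)
    · simp [hl]
  exact_mod_cast h3

/-- A module with jointly injective functionals that are triangular on a family of elements, with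
diagonal entries dividing the possible leading values, is free on that family. -/
theorem Module.Basis.exists_of_triangular {S M : Type*} [CommRing S] [IsDomain S] [AddCommGroup M]
    [Module S M] {m : ℕ} (φ : Fin m → M →ₗ[S] S) (e : Fin m → M)
    (hinj : ∀ r, (∀ i, φ i r = 0) → r = 0) (hdiag : ∀ i, φ i (e i) ≠ 0)
    (htri : ∀ i j, j < i → φ j (e i) = 0)
    (hdvd : ∀ i r, (∀ j < i, φ j r = 0) → φ i (e i) ∣ φ i r) :
    Nonempty (Module.Basis (Fin m) S M) := by
  refine ⟨Module.Basis.mk (v := e) ?_ ?_⟩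
  · rw [Fintype.linearIndependent_iff]
    intro g hg i
    induction i using WellFoundedLT.induction with
    | _ i ih =>
      have h := congrArg (φ i) hg
      rw [map_sum, map_zero, Finset.sum_eq_single i] at h
      · simpa [hdiag i] using h
      · intro j _ hj
        rcases lt_or_gt_of_ne hj with h' | h'
        · simp [ih j h']
        · simp [htri j i h']
      · simp
  · intro r _
    -- Gaussian elimination: the first `k` coordinates are cleared, and `hdvd` makes the next one a
    -- multiple of the diagonal entry.
    have key : ∀ k ≤ m, ∃ s ∈ Submodule.span S (Set.range e),
        ∀ j : Fin m, j.1 < k → φ j (r - s) = 0 := by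
      intro k
      induction k with
      | zero => exact fun _ => ⟨0, zero_mem _, by simp⟩
      | succ k ih =>
        intro hk
        obtain ⟨s, hs, hs'⟩ := ih (by omega)
        obtain ⟨c, hc⟩ := hdvd ⟨k, hk⟩ (r - s) (fun j hj => hs' j hj)
        refine ⟨s + c • e ⟨k, hk⟩, add_mem hs (Submodule.smul_mem _ _
          (Submodule.subset_span ⟨_, rfl⟩)), fun j hj => ?_⟩
        rw [← sub_sub, map_sub, map_smul, smul_eq_mul]
        rcases Nat.lt_succ_iff_lt_or_eq.1 hj with h | h
        · rw [hs' j h, htri _ j h]; simp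
        · obtain rfl : j = ⟨k, hk⟩ := Fin.ext h
          rw [hc]; ring
    obtain ⟨s, hs, hs'⟩ := key m le_rfl
    rwa [sub_eq_zero.1 (hinj _ fun i => hs' i i.2)]

/-- As `φ i ∘ ψ` is the identity, each `φ i` is linear for the module structure given by `ψ`. -/
theorem isCohenMacaulayRing_of_triangular {K R : Type*} [Field K] [CommRing R] {n m : ℕ}
    (ψ : MvPolynomial (Fin n) K →+* R) (φ : Fin m → R →+* MvPolynomial (Fin n) K)
    (hφψ : ∀ i s, φ i (ψ s) = s) (e : Fin m → R)
    (hinj : ∀ r, (∀ i, φ i r = 0) → r = 0) (hdiag : ∀ i, φ i (e i) ≠ 0)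
    (htri : ∀ i j, j < i → φ j (e i) = 0)
    (hdvd : ∀ i r, (∀ j < i, φ j r = 0) → φ i (e i) ∣ φ i r) : IsCohenMacaulayRing R := by
  let : Algebra (MvPolynomial (Fin n) K) R := ψ.toAlgebra
  obtain ⟨b⟩ := Module.Basis.exists_of_triangular (S := MvPolynomial (Fin n) K)
    (fun i => { toFun := φ i
                map_add' := map_add _
                map_smul' := fun s r => by
                  rw [Algebra.smul_def, map_mul, RingHom.algebraMap_toAlgebra, hφψ]; rfl })
    e hinj hdiag htri hdvd
  have := Module.Finite.of_basis b
  have := Module.Free.of_basis b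
  exact isCohenMacaulayRing_of_finite_flat K R n

/-! ### Right pairings, their facets and the shelling. -/

namespace SimpleGraph

variable {W : Type*} {H : SimpleGraph W} {s : W → W}

/-- `s` is an involution whose orbits `{x, s x}` are right edges of `H`, and `H` has no other right
edges. -/
structure IsRightPairing (H : SimpleGraph W) (s : W → W) : Prop where
  involutive : ∀ x, s (s x) = x
  adj : ∀ x, H.Adj x (s x)
  square : ∀ x u w, H.Adj x u → H.Adj (s x) w → H.Adj u w
  antisymm : ∀ x y, H.Adj x (s y) → H.Adj y (s x) → x = y

/-- The independent sets of `H` that meet each orbit `{x, s x}` in exactly one vertex. -/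
structure IsPairingFacet (H : SimpleGraph W) (s : W → W) (F : Finset W) : Prop where
  mem_iff : ∀ x, x ∈ F ↔ s x ∉ F
  indep : ∀ x ∈ F, ∀ y ∈ F, ¬ H.Adj x y

/-- The order in which `x ≤ y` means that `x` is adjacent to the partner of `y`. -/
abbrev IsRightPairing.partialOrder (h : H.IsRightPairing s) : PartialOrder W where
  le x y := H.Adj x (s y)
  le_refl := h.adj
  le_trans x y z hxy hyz := (h.square y _ _ hyz hxy.symm).symm
  le_antisymm := h.antisymm

/-- Facets are up-sets: independence excludes `s z`, so `z` is chosen from its pair. -/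
theorem IsPairingFacet.mem_of_adj {F : Finset W} (hF : H.IsPairingFacet s F) {x z : W}
    (hx : x ∈ F) (hxz : H.Adj x (s z)) : z ∈ F := by
  rw [hF.mem_iff]
  exact fun hz => hF.indep _ hx _ hz hxz

theorem IsPairingFacet.two_mul_card [Fintype W] {F : Finset W} (h : H.IsRightPairing s)
    (hF : H.IsPairingFacet s F) : 2 * F.card = Fintype.card W := by
  classical
  have hc : Fᶜ = F.image s := by
    ext x
    rw [Finset.mem_compl, Finset.mem_image]
    constructor
    · intro hx
      refine ⟨s x, ?_, h.involutive x⟩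
      rwa [hF.mem_iff, h.involutive]
    · rintro ⟨y, hy, rfl⟩
      exact (hF.mem_iff y).1 hy
  have hs : Function.Injective s := Function.Involutive.injective h.involutive
  have := Finset.card_add_card_compl F
  rw [hc, Finset.card_image_of_injective _ hs] at this
  omega

/-- If a maximal independent set missed both `x` and `s x`, each would have a neighbour in it, and
the square condition would make these neighbours adjacent. -/
theorem IsRightPairing.exists_isPairingFacet_superset [Finite W] (h : H.IsRightPairing s)
    (I : Finset W) (hI : ∀ x ∈ I, ∀ y ∈ I, ¬ H.Adj x y) :
    ∃ F, I ⊆ F ∧ H.IsPairingFacet s F := by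
  classical
  obtain ⟨F, hIF, hF⟩ := Set.Finite.exists_le_maximal
    (Set.toFinite {J : Finset W | ∀ x ∈ J, ∀ y ∈ J, ¬ H.Adj x y}) hI
  have hins : ∀ x, x ∉ F → ∃ u ∈ F, H.Adj x u := by
    intro x hx
    by_contra! hc
    refine hx (hF.2 (y := insert x F) ?_ (Finset.subset_insert _ _) (Finset.mem_insert_self _ _))
    intro a ha b hb hab
    rcases Finset.mem_insert.1 ha with rfl | ha' <;>
      rcases Finset.mem_insert.1 hb with rfl | hb'
    · exact H.loopless.irrefl _ hab
    · exact hc _ hb' hab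
    · exact hc _ ha' hab.symm
    · exact hF.1 a ha' b hb' hab
  refine ⟨F, hIF, ⟨fun x => ⟨fun hx hsx => hF.1 _ hx _ hsx (h.adj x), fun hsx => ?_⟩, hF.1⟩⟩
  by_contra hx
  obtain ⟨u, hu, hxu⟩ := hins x hx
  obtain ⟨w, hw, hxw⟩ := hins _ hsx
  exact hF.1 u hu w hw (h.square x u w hxu hxw)

/-- Replacing a minimal vertex of a facet by its partner gives a facet. -/
theorem IsPairingFacet.flip [DecidableEq W] (h : H.IsRightPairing s) {F : Finset W}
    (hF : H.IsPairingFacet s F) {v : W} (hv : v ∈ F)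
    (hmin : ∀ x ∈ F, H.Adj x (s v) → x = v) :
    H.IsPairingFacet s (insert (s v) (F.erase v)) := by
  have hsv : s v ∉ F := (hF.mem_iff v).1 hv
  refine ⟨fun x => ?_, fun x hx y hy hxy => ?_⟩
  · simp only [Finset.mem_insert, Finset.mem_erase]
    by_cases h1 : x = v
    · subst h1
      simp [(h.adj x).ne]
    · by_cases h2 : x = s v
      · subst h2
        simp [h.involutive, (h.adj v).ne]
      · have h3 : s x ≠ s v := fun e => h1 (by rw [← h.involutive x, e, h.involutive])
        have h4 : s x ≠ v := fun e => h2 (by rw [← e, h.involutive])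
        simp [h1, h2, h3, h4, hF.mem_iff x]
  · simp only [Finset.mem_insert, Finset.mem_erase] at hx hy
    rcases hx with rfl | ⟨hx1, hx⟩ <;> rcases hy with rfl | ⟨hy1, hy⟩
    · exact H.loopless.irrefl _ hxy
    · exact hy1 (hmin y hy hxy.symm)
    · exact hx1 (hmin x hx hxy)
    · exact hF.indep x hx y hy hxy

/-- If `F ⊆ F' ∪ F₀`, the cardinality bound forces `F \ F₀ = F' \ F₀`, which determines the facet.
Otherwise a minimal `v` of the difference is minimal in `F`: an `x ≤ v` in one of the up-sets `F'`,
`F₀` would put `v` there. -/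
theorem IsPairingFacet.exists_minimal_notMem [DecidableEq W] (h : H.IsRightPairing s)
    {F F' F₀ : Finset W} (hF : H.IsPairingFacet s F) (hF' : H.IsPairingFacet s F')
    (hF₀ : H.IsPairingFacet s F₀) (hne : F ≠ F') (hcard : (F' \ F₀).card ≤ (F \ F₀).card) :
    ∃ v ∈ F, v ∉ F' ∧ v ∉ F₀ ∧ ∀ x ∈ F, H.Adj x (s v) → x = v := by
  have hT : (F \ (F' ∪ F₀)).Nonempty := by
    by_contra hT
    rw [Finset.not_nonempty_iff_eq_empty, Finset.sdiff_eq_empty_iff_subset] at hT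
    have hsub : F \ F₀ ⊆ F' \ F₀ := by
      intro x hx
      have := hT (Finset.mem_sdiff.1 hx).1
      grind
    have heq := Finset.eq_of_subset_of_card_le hsub hcard
    have hmem : ∀ x, x ∉ F₀ → (x ∈ F ↔ x ∈ F') := by
      intro x hx
      have := Finset.ext_iff.1 heq x
      simpa [hx] using this
    refine hne (Finset.ext fun x => ?_)
    by_cases hx : x ∈ F₀
    · rw [hF.mem_iff, hF'.mem_iff, hmem _ ((hF₀.mem_iff x).1 hx)]
    · exact hmem x hx
  let := h.partialOrder
  obtain ⟨v, hv⟩ := Finset.exists_minimal hT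
  have hv' := hv.1
  simp only [Finset.mem_sdiff, Finset.mem_union, not_or] at hv'
  refine ⟨v, hv'.1, hv'.2.1, hv'.2.2, fun x hx hxv => ?_⟩
  refine hv.eq_of_le ?_ hxv
  simp only [Finset.mem_sdiff, Finset.mem_union, not_or]
  exact ⟨hx, fun hx' => hv'.2.1 (hF'.mem_of_adj hx' hxv),
    fun hx' => hv'.2.2 (hF₀.mem_of_adj hx' hxv)⟩

theorem IsRightPairing.exists_shelling [Finite W] [DecidableEq W] (h : H.IsRightPairing s) :
    ∃ (m : ℕ) (F : Fin m → Finset W), Function.Injective F ∧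
      (∀ A, H.IsPairingFacet s A ↔ ∃ i, F i = A) ∧
      ∀ i j, j < i → ∃ v ∈ F i, v ∉ F j ∧ ∃ k < i, F k = insert (s v) ((F i).erase v) := by
  obtain ⟨F₀, -, hF₀⟩ := h.exists_isPairingFacet_superset ∅ (by simp)
  obtain ⟨m, ⟨ε⟩⟩ := Finite.exists_equiv_fin {A : Finset W // H.IsPairingFacet s A}
  let f : Fin m → ℕ := fun i => ((ε.symm i).1 \ F₀).card
  let F : Fin m → Finset W := fun i => (ε.symm (Tuple.sort f i)).1
  have hmono : Monotone fun i => (F i \ F₀).card := Tuple.monotone_sort f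
  have hinj : Function.Injective F := fun i j hij =>
    (Tuple.sort f).injective (ε.symm.injective (Subtype.ext hij))
  have hrange : ∀ A, H.IsPairingFacet s A ↔ ∃ i, F i = A := by
    refine fun A => ⟨fun hA => ⟨(Tuple.sort f).symm (ε ⟨A, hA⟩), by simp [F]⟩, ?_⟩
    rintro ⟨i, rfl⟩
    exact (ε.symm (Tuple.sort f i)).2
  refine ⟨m, F, hinj, hrange, fun i j hji => ?_⟩
  have hFi := (hrange (F i)).2 ⟨i, rfl⟩
  obtain ⟨v, hvi, hvj, hv₀, hmin⟩ := hFi.exists_minimal_notMem h ((hrange (F j)).2 ⟨j, rfl⟩) hF₀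
    (fun e => hji.ne' (hinj e)) (hmono hji.le)
  obtain ⟨k, hk⟩ := (hrange _).1 (hFi.flip h hvi hmin)
  -- The flip trades `v ∉ F₀` for `s v ∈ F₀`, so the sorted quantity drops strictly and `k` precedes
  -- `i`.
  refine ⟨v, hvi, hvj, k, lt_of_not_ge fun hik => ?_, hk⟩
  have hle : (F i \ F₀).card ≤ (F k \ F₀).card := hmono hik
  refine hle.not_gt (Finset.card_lt_card ⟨fun x hx => ?_, fun hsub => ?_⟩)
  · rw [hk] at hx
    have hsv : s v ∈ F₀ := by
      by_contra hc
      exact hv₀ ((hF₀.mem_iff v).2 hc)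
    simp only [Finset.mem_sdiff, Finset.mem_insert, Finset.mem_erase] at hx ⊢
    rcases hx with ⟨rfl | hx, hx'⟩
    · exact absurd hsv hx'
    · exact ⟨hx.2, hx'⟩
  · have := hsub (Finset.mem_sdiff.2 ⟨hvi, hv₀⟩)
    rw [hk] at this
    simp [(h.adj v).ne] at this

/-! ### The edge ideal and restriction to facets. -/

section EdgeIdeal

variable {K : Type*} [Field K]

/-- For independent `A`, evaluation at the indicator of `A` kills the ideal but not the product. -/
theorem prod_X_mem_edgeIdeal_iff (H : SimpleGraph W) (A : Finset W) :
    ∏ i ∈ A, (MvPolynomial.X i : MvPolynomial W K) ∈ H.edgeIdeal K ↔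
      ∃ x ∈ A, ∃ y ∈ A, H.Adj x y := by
  classical
  constructor
  · intro hmem
    by_contra! hc
    let χ : MvPolynomial W K →+* K := MvPolynomial.eval fun i => if i ∈ A then 1 else 0
    have hle : H.edgeIdeal K ≤ RingHom.ker χ := by
      refine Ideal.span_le.2 ?_
      rintro _ ⟨i, j, hij, rfl⟩
      by_cases hi : i ∈ A <;> by_cases hj : j ∈ A
      · exact absurd hij (hc i hi j hj)
      all_goals simp [χ, RingHom.mem_ker, hi, hj]
    have h1 := hle hmem
    rw [RingHom.mem_ker, map_prod, Finset.prod_congr rfl (g := fun _ => (1 : K))] at h1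
    · simp at h1
    · intro x hx
      simp [χ, hx]
  · rintro ⟨x, hx, y, hy, hxy⟩
    have hdvd : (MvPolynomial.X x * MvPolynomial.X y : MvPolynomial W K) ∣
        ∏ i ∈ A, MvPolynomial.X i := by
      rw [← Finset.prod_pair hxy.ne]
      exact Finset.prod_dvd_prod_of_subset _ _ _ (by grind)
    exact Ideal.mem_of_dvd _ hdvd (Ideal.subset_span ⟨x, y, hxy, rfl⟩)

theorem mem_edgeIdeal_of_support (H : SimpleGraph W) (r : MvPolynomial W K)
    (hr : ∀ m ∈ r.support, ∃ x ∈ m.support, ∃ y ∈ m.support, H.Adj x y) : r ∈ H.edgeIdeal K := by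
  classical
  have : H.edgeIdeal K = Ideal.span ((fun m => MvPolynomial.monomial m (1 : K)) ''
      {m | ∃ i j, H.Adj i j ∧ m = Finsupp.single i 1 + Finsupp.single j 1}) := by
    unfold edgeIdeal
    congr 1
    ext p
    constructor
    · rintro ⟨i, j, hij, rfl⟩
      exact ⟨_, ⟨i, j, hij, rfl⟩, by simp [MvPolynomial.X, MvPolynomial.monomial_mul]⟩
    · rintro ⟨_, ⟨i, j, hij, rfl⟩, rfl⟩
      exact ⟨i, j, hij, by simp [MvPolynomial.X, MvPolynomial.monomial_mul]⟩
  rw [this, MvPolynomial.mem_ideal_span_monomial_image]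
  intro m hm
  obtain ⟨x, hx, y, hy, hxy⟩ := hr m hm
  refine ⟨_, ⟨x, y, hxy, rfl⟩, fun z => ?_⟩
  rw [Finsupp.mem_support_iff] at hx hy
  -- Since `x ≠ y`, exponent one at each suffices for divisibility.
  have := hxy.ne
  simp only [Finsupp.add_apply, Finsupp.single_apply]
  split_ifs with h1 h2 h2
  · exact absurd (h1.trans h2.symm) this
  · subst h1; omega
  · subst h2; omega
  · omega

theorem mem_idealComplex_edgeIdeal_iff (H : SimpleGraph W) (A : Finset W) :
    A ∈ MvPolynomial.idealComplex (H.edgeIdeal K) ↔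
      A.Nonempty ∧ ∀ x ∈ A, ∀ y ∈ A, ¬ H.Adj x y := by
  change A.Nonempty ∧ ∏ i ∈ A, (MvPolynomial.X i : MvPolynomial W K) ∉ H.edgeIdeal K ↔ _
  rw [prod_X_mem_edgeIdeal_iff]
  push Not
  rfl

/-- Nonemptiness matters only without vertices, as the empty face is not recorded. -/
theorem IsRightPairing.isFacet_iff [Finite W] (h : H.IsRightPairing s) (F : Finset W) :
    (MvPolynomial.idealComplex (H.edgeIdeal K)).IsFacet F ↔
      F.Nonempty ∧ H.IsPairingFacet s F := by
  constructor
  · rintro ⟨hF, hmax⟩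
    rw [mem_idealComplex_edgeIdeal_iff] at hF
    obtain ⟨F', hsub, hF'⟩ := h.exists_isPairingFacet_superset F hF.2
    rw [hmax F' ((mem_idealComplex_edgeIdeal_iff H F').2 ⟨hF.1.mono hsub, hF'.indep⟩) hsub]
    exact ⟨hF.1.mono hsub, hF'⟩
  · rintro ⟨hne, hF⟩
    refine ⟨(mem_idealComplex_edgeIdeal_iff H F).2 ⟨hne, hF.indep⟩, fun F' hF' hsub => ?_⟩
    rw [mem_idealComplex_edgeIdeal_iff] at hF'
    refine hsub.antisymm fun x hx => ?_
    rw [hF.mem_iff]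
    exact fun hsx => hF'.2 x hx _ (hsub hsx) (h.adj x)

theorem IsRightPairing.isShellable [Finite W] (h : H.IsRightPairing s) :
    (MvPolynomial.idealComplex (H.edgeIdeal K)).IsShellable := by
  classical
  have := Fintype.ofFinite W
  constructor
  · intro F F' hF hF'
    have h1 := (((h.isFacet_iff F).1 hF).2).two_mul_card h
    have h2 := (((h.isFacet_iff F').1 hF').2).two_mul_card h
    omega
  rcases isEmpty_or_nonempty W with hW | ⟨⟨w⟩⟩
  · refine ⟨0, fun i => i.elim0, fun i => i.elim0, fun A => ?_, fun i => i.elim0⟩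
    rw [h.isFacet_iff]
    simp [Finset.eq_empty_of_isEmpty A]
  · obtain ⟨m, F, hinj, hrange, hshell⟩ := h.exists_shelling
    refine ⟨m, F, hinj, fun A => ?_, fun i j hij => ?_⟩
    · rw [h.isFacet_iff, ← hrange, and_iff_right_iff_imp]
      intro hA
      by_cases hw : w ∈ A
      · exact ⟨w, hw⟩
      · by_contra hne
        exact hw ((hA.mem_iff w).2 fun hsw => hne ⟨_, hsw⟩)
    · obtain ⟨v, hvi, hvj, k, hk, hFk⟩ := hshell i j hij
      refine ⟨v, hvi, hvj, k, hk, ?_⟩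
      have hsv : s v ∉ F i := (((hrange (F i)).2 ⟨i, rfl⟩).mem_iff v).1 hvi
      have := (h.adj v).ne
      rw [hFk]
      ext x
      simp only [Set.mem_sdiff, Finset.mem_coe, Finset.mem_insert, Finset.mem_erase,
        Set.mem_singleton_iff]
      grind

/-- The variables of the facet `F` are sent to the variables of their pairs, the others to `0`. -/
noncomputable def facetHom [DecidableEq W] (K : Type*) [Field K] {n : ℕ} (π : W → Fin n)
    (F : Finset W) : MvPolynomial W K →ₐ[K] MvPolynomial (Fin n) K :=
  MvPolynomial.aeval fun v => if v ∈ F then MvPolynomial.X (π v) else 0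

variable [DecidableEq W] {n : ℕ} {π : W → Fin n}

@[simp]
theorem facetHom_X (π : W → Fin n) (F : Finset W) (v : W) :
    facetHom K π F (MvPolynomial.X v) = if v ∈ F then MvPolynomial.X (π v) else 0 := by
  simp [facetHom]

theorem IsPairingFacet.facetHom_eq_zero {F : Finset W} (hF : H.IsPairingFacet s F)
    (π : W → Fin n) {r : MvPolynomial W K} (hr : r ∈ H.edgeIdeal K) : facetHom K π F r = 0 := by
  have hle : H.edgeIdeal K ≤ RingHom.ker (facetHom K π F) := by
    refine Ideal.span_le.2 ?_
    rintro _ ⟨i, j, hij, rfl⟩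
    by_cases hi : i ∈ F <;> by_cases hj : j ∈ F
    · exact absurd hij (hF.indep i hi j hj)
    all_goals simp [RingHom.mem_ker, hi, hj]
  exact hle hr

/-- Monomials supported in `F` are renamed injectively; all others vanish. -/
theorem coeff_facetHom {F : Finset W} (hinj : Set.InjOn π F) {m : W →₀ ℕ}
    (hm : m.support ⊆ F) (r : MvPolynomial W K) :
    (facetHom K π F r).coeff (m.mapDomain π) = r.coeff m := by
  induction r using MvPolynomial.induction_on' with
  | add p q hp hq => rw [map_add, MvPolynomial.coeff_add, MvPolynomial.coeff_add, hp, hq]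
  | monomial u a =>
    by_cases hu : u.support ⊆ F
    · have : facetHom K π F (MvPolynomial.monomial u a) =
          MvPolynomial.monomial (u.mapDomain π) a := by
        rw [← MvPolynomial.rename_monomial, facetHom, MvPolynomial.rename_eq_aeval,
          MvPolynomial.aeval_monomial, MvPolynomial.aeval_monomial]
        congr 1
        refine Finsupp.prod_congr fun x hx => ?_
        simp [hu hx]
      rw [this, MvPolynomial.coeff_monomial, MvPolynomial.coeff_monomial]
      congr 1
      have := (Finsupp.mapDomain_injOn (M := ℕ) (F : Set W) hinj).eq_iff (x := u) (y := m)
        (by exact_mod_cast hu) (by exact_mod_cast hm)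
      exact propext this
    · obtain ⟨x, hx, hxF⟩ := Finset.not_subset.1 hu
      have : facetHom K π F (MvPolynomial.monomial u a) = 0 := by
        rw [facetHom, MvPolynomial.aeval_monomial, Finsupp.prod, Finset.prod_eq_zero hx, mul_zero]
        rw [if_neg hxF, zero_pow (Finsupp.mem_support_iff.1 hx)]
      rw [this, MvPolynomial.coeff_zero, MvPolynomial.coeff_monomial, if_neg]
      rintro rfl
      exact hu hm

/-- A monomial outside the ideal has independent support, hence survives on a facet containing that
support. -/
theorem IsRightPairing.mem_edgeIdeal_of_facetHom_eq_zero [Finite W] (h : H.IsRightPairing s)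
    (hπ : ∀ u v, π u = π v ↔ u = v ∨ u = s v) {r : MvPolynomial W K}
    (hr : ∀ F, H.IsPairingFacet s F → facetHom K π F r = 0) : r ∈ H.edgeIdeal K := by
  refine mem_edgeIdeal_of_support H r fun m hm => ?_
  by_contra! hc
  obtain ⟨F, hmF, hF⟩ := h.exists_isPairingFacet_superset m.support hc
  have hinj : Set.InjOn π F := by
    intro u hu v hv huv
    rcases (hπ u v).1 huv with rfl | rfl
    · rfl
    · exact absurd hu ((hF.mem_iff v).1 hv)
  have := coeff_facetHom hinj hmF r
  rw [hr F hF, MvPolynomial.coeff_zero] at this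
  exact MvPolynomial.mem_support_iff.1 hm this.symm

/-- Modulo the variable of the pair, `v` and `s v` both go to zero, so the two restrictions agree.
-/
theorem X_dvd_facetHom_sub_facetHom_flip {F : Finset W} {v : W} (hπ : π (s v) = π v)
    (hv : v ∈ F) (hsv : s v ∉ F) (r : MvPolynomial W K) :
    MvPolynomial.X (π v) ∣
      facetHom K π F r - facetHom K π (insert (s v) (F.erase v)) r := by
  rw [← Ideal.mem_span_singleton, ← Ideal.Quotient.eq]
  let q := Ideal.Quotient.mkₐ K (Ideal.span {(MvPolynomial.X (π v) : MvPolynomial (Fin n) K)})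
  have hq : q (MvPolynomial.X (π v)) = 0 :=
    Ideal.Quotient.eq_zero_iff_mem.2 (Ideal.mem_span_singleton_self _)
  have : q.comp (facetHom K π F) = q.comp (facetHom K π (insert (s v) (F.erase v))) := by
    refine MvPolynomial.algHom_ext fun u => ?_
    simp only [AlgHom.comp_apply, facetHom_X, Finset.mem_insert, Finset.mem_erase]
    by_cases h1 : u = v
    · subst h1
      simp [hv, hq, apply_ite q]
    · by_cases h2 : u = s v
      · subst h2
        simp [hsv, hπ, hq]
      · simp [h1, h2]
  exact DFunLike.congr_fun this r

end EdgeIdeal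

theorem IsRightPairing.exists_pair_index [Finite W] (h : H.IsRightPairing s) :
    ∃ (n : ℕ) (π : W → Fin n), Function.Surjective π ∧
      ∀ u v, π u = π v ↔ u = v ∨ u = s v := by
  let S : Setoid W :=
    { r := fun u v => u = v ∨ u = s v
      iseqv := ⟨fun _ => Or.inl rfl, by
        rintro u v (rfl | rfl)
        · exact Or.inl rfl
        · exact Or.inr (h.involutive v).symm, by
        rintro u v w (rfl | rfl) (rfl | rfl)
        · exact Or.inl rfl
        · exact Or.inr rfl
        · exact Or.inr rfl
        · exact Or.inl (h.involutive w)⟩ }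
  obtain ⟨n, ⟨ε⟩⟩ := Finite.exists_equiv_fin (Quotient S)
  refine ⟨n, fun w => ε (Quotient.mk S w), ε.surjective.comp Quotient.mk_surjective, fun u v => ?_⟩
  rw [ε.apply_eq_iff_eq, Quotient.eq]
  rfl

theorem IsRightPairing.isCohenMacaulayOver [Finite W] (h : H.IsRightPairing s) (K : Type*)
    [Field K] : H.IsCohenMacaulayOver K := by
  classical
  obtain ⟨m, F, hinj, hrange, hshell⟩ := h.exists_shelling
  obtain ⟨n, π, hsurj, hπ⟩ := h.exists_pair_index
  have hF : ∀ i, H.IsPairingFacet s (F i) := fun i => (hrange _).2 ⟨i, rfl⟩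
  have hπs : ∀ v, π (s v) = π v := fun v => (hπ _ _).2 (Or.inr rfl)
  obtain ⟨ρ, hρ⟩ := hsurj.hasRightInverse
  let mk := Ideal.Quotient.mkₐ K (H.edgeIdeal K)
  let φ : Fin m → (MvPolynomial W K ⧸ H.edgeIdeal K) →ₐ[K] MvPolynomial (Fin n) K := fun i =>
    Ideal.Quotient.liftₐ (H.edgeIdeal K) (facetHom K π (F i))
      fun r hr => (hF i).facetHom_eq_zero π hr
  have hφ : ∀ i r, φ i (mk r) = facetHom K π (F i) r := fun i r => rfl
  have hmk : Function.Surjective mk := Ideal.Quotient.mk_surjective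
  let ψ : MvPolynomial (Fin n) K →ₐ[K] MvPolynomial W K ⧸ H.edgeIdeal K :=
    MvPolynomial.aeval fun p => mk (MvPolynomial.X (ρ p) + MvPolynomial.X (s (ρ p)))
  -- The vertices of `F i` whose flip is an earlier facet; their monomial is the basis element for
  -- `F i`.
  let R : Fin m → Finset W := fun i =>
    (F i).filter fun v => ∃ k < i, F k = insert (s v) ((F i).erase v)
  have hdiag : ∀ i, φ i (mk (∏ v ∈ R i, MvPolynomial.X v)) =
      ∏ v ∈ R i, MvPolynomial.X (π v) := by
    intro i
    rw [hφ, map_prod]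
    refine Finset.prod_congr rfl fun v hv => ?_
    rw [facetHom_X, if_pos (Finset.mem_filter.1 hv).1]
  refine isCohenMacaulayRing_of_triangular (K := K) ψ.toRingHom (fun i => (φ i).toRingHom)
    ?_ (fun i => mk (∏ v ∈ R i, MvPolynomial.X v)) ?_ ?_ ?_ ?_
  · intro i p
    have : (φ i).comp ψ = AlgHom.id K _ := by
      refine MvPolynomial.algHom_ext fun p => ?_
      simp only [AlgHom.comp_apply, ψ, MvPolynomial.aeval_X, hφ, map_add, facetHom_X, hπs,
        AlgHom.id_apply]
      rw [hρ p]
      have := (hF i).mem_iff (ρ p)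
      by_cases hp : ρ p ∈ F i
      · simp [hp, this.1 hp]
      · have : s (ρ p) ∈ F i := by
          by_contra hc
          exact hp (this.2 hc)
        simp [hp, this]
    exact DFunLike.congr_fun this p
  · intro r hr
    obtain ⟨r, rfl⟩ := hmk r
    refine Ideal.Quotient.eq_zero_iff_mem.2 (h.mem_edgeIdeal_of_facetHom_eq_zero hπ ?_)
    intro A hA
    obtain ⟨i, rfl⟩ := (hrange A).1 hA
    exact hr i
  · intro i
    change φ i (mk _) ≠ 0
    rw [hdiag, Finset.prod_ne_zero_iff]
    exact fun v _ => MvPolynomial.X_ne_zero _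
  · intro i j hji
    change φ j (mk _) = 0
    -- The shelling vertex lies in `R i` but not in `F j`, so its factor restricts to zero.
    obtain ⟨v, hvi, hvj, k, hk, hFk⟩ := hshell i j hji
    rw [hφ, map_prod]
    refine Finset.prod_eq_zero (i := v) (Finset.mem_filter.2 ⟨hvi, k, hk, hFk⟩) ?_
    rw [facetHom_X, if_neg hvj]
  · intro i r hr
    change φ i (mk _) ∣ φ i r
    rw [hdiag]
    obtain ⟨r, rfl⟩ := hmk r
    -- Vertices of one facet lie in distinct pairs, giving coprime variables. Each divides, because
    -- `r` vanishes on the corresponding earlier flip.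
    refine Finset.prod_dvd_of_isRelPrime ?_ ?_
    · intro u hu v hv huv
      rw [Finset.mem_coe] at hu hv
      have hne : π u ≠ π v := by
        rw [Ne, hπ, not_or]
        refine ⟨huv, ?_⟩
        rintro rfl
        exact ((hF i).mem_iff v).1 (Finset.mem_filter.1 hv).1 (Finset.mem_filter.1 hu).1
      change IsRelPrime _ _
      rw [(MvPolynomial.X_prime (R := K) (i := π u)).irreducible.isRelPrime_iff_not_dvd,
        MvPolynomial.X_dvd_X]
      exact hne
    · intro v hv
      obtain ⟨hvi, k, hk, hFk⟩ := Finset.mem_filter.1 hv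
      have h1 := X_dvd_facetHom_sub_facetHom_flip (K := K) (hπs v) hvi
        (((hF i).mem_iff v).1 hvi) r
      have h2 : facetHom K π (F k) r = 0 := hr k hk
      rw [← hFk, h2, sub_zero] at h1
      exact h1

end SimpleGraph

/-! ### The pairing on the projected graph. -/

namespace SimpleGraph

variable {V : Type*} {G : SimpleGraph V}

theorem IsRightEdge.symm {i j : V} (h : G.IsRightEdge i j) : G.IsRightEdge j i :=
  G.zeroOneGraph.symm.symm _ _ h

/-- A path of three right edges closes up to a right edge. -/
theorem IsRightEdge.trans {a b c d : V} (hab : G.IsRightEdge a b) (hbc : G.IsRightEdge b c)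
    (hcd : G.IsRightEdge c d) : G.IsRightEdge a d := by
  refine ⟨hbc.2 a d hab.1.symm hcd.1, fun a' d' ha hd => ?_⟩
  have h1 : G.Adj a' c := hab.2 a' c ha hbc.1
  exact hcd.2 a' d' h1.symm hd

theorem setOf_isRightEdge_eq {v w x : V} (hv : G.IsRightEdge v x) (hw : G.IsRightEdge w x) :
    {y | G.IsRightEdge v y} = {y | G.IsRightEdge w y} :=
  Set.ext fun _ => ⟨fun h => hw.trans hv.symm h, fun h => hv.trans hw.symm h⟩

/-- If every vertex lies on a right edge, the vertices of the projected graph are the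
neighbourhoods in the graph of right edges. -/
theorem WeakSquareCondition.isProjVertex_iff (hG : G.WeakSquareCondition) (U : Set V) :
    G.IsProjVertex U ↔ ∃ v, U = {x | G.IsRightEdge v x} := by
  have hG' : ∀ v, ∃ w, G.IsRightEdge v w := hG
  constructor
  · rintro (⟨v, hv, -⟩ | ⟨C, W, hC⟩)
    · obtain ⟨w, hw⟩ := hG' v
      exact absurd hw (hv w)
    · obtain ⟨w, hw⟩ := hC.right_nonempty
      have hwS : w ∈ C.supp := hC.union_eq ▸ Or.inr hw
      refine ⟨w, Set.ext fun x => ⟨fun hx => ?_, fun hx => ?_⟩⟩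
      · exact (hC.adj_iff w hwS x (hC.union_eq ▸ Or.inl hx)).2 (Or.inr ⟨hw, hx⟩)
      · have hxS : x ∈ C.supp := C.mem_supp_of_adj_mem_supp hwS hx
        rcases (hC.adj_iff w hwS x hxS).1 hx with h | h
        · exact absurd hw (Set.disjoint_left.1 hC.disjoint h.1)
        · exact h.2
  · rintro ⟨v, rfl⟩
    obtain ⟨u, hu⟩ := hG' v
    refine Or.inr ⟨G.zeroOneGraph.connectedComponentMk v, {x | G.IsRightEdge u x}, ?_⟩
    -- Each step along right edges switches between the two neighbourhoods, so their union is the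
    -- whole component.
    have hreach : ∀ a b, G.zeroOneGraph.Reachable a b →
        a ∈ {x | G.IsRightEdge v x} ∪ {x | G.IsRightEdge u x} →
        b ∈ {x | G.IsRightEdge v x} ∪ {x | G.IsRightEdge u x} := by
      rintro a b ⟨p⟩
      induction p with
      | nil => exact id
      | cons h _ ih =>
        rintro (ha | ha)
        · exact ih (Or.inr (hu.symm.trans ha h))
        · exact ih (Or.inl (hu.trans ha h))
    have hsupp : {x | G.IsRightEdge v x} ∪ {x | G.IsRightEdge u x} =
        (G.zeroOneGraph.connectedComponentMk v).supp := by
      ext x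
      rw [ConnectedComponent.mem_supp_iff, ConnectedComponent.eq]
      constructor
      · rintro (hx | hx)
        · exact (Adj.reachable (G := G.zeroOneGraph) hx).symm
        · exact ((Adj.reachable (G := G.zeroOneGraph) hu).trans
            (Adj.reachable (G := G.zeroOneGraph) hx)).symm
      · exact fun hx => hreach v x hx.symm (Or.inr hu.symm)
    have hcross : ∀ x y, G.IsRightEdge v x → G.IsRightEdge u y → G.IsRightEdge x y :=
      fun x y hx hy => hx.symm.trans hu hy
    have hirr : ∀ w x y, G.IsRightEdge w x → G.IsRightEdge w y → ¬ G.Adj x y :=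
      fun w x y hx hy hxy => G.loopless.irrefl _ (hx.symm.2 y y hxy hy.1)
    refine ⟨⟨u, hu⟩, ⟨v, hu.symm⟩, Set.disjoint_left.2 fun x hx hx' => ?_, hsupp,
      fun x hx y hy => ?_⟩
    · exact G.loopless.irrefl _ (hcross x x hx hx').1
    · rw [← hsupp] at hx hy
      constructor
      · intro hxy
        rcases hx with hx | hx <;> rcases hy with hy | hy
        · exact absurd hxy.1 (hirr v x y hx hy)
        · exact Or.inl ⟨hx, hy⟩
        · exact Or.inr ⟨hx, hy⟩
        · exact absurd hxy.1 (hirr u x y hx hy)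
      · rintro (⟨h1, h2⟩ | ⟨h1, h2⟩)
        · exact hcross x y h1 h2
        · exact (hcross y x h2 h1).symm

theorem WeakSquareCondition.exists_isRightPairing_proj (hG : G.WeakSquareCondition) :
    ∃ σ : G.ProjVertex → G.ProjVertex, G.proj.IsRightPairing σ := by
  have hG' : ∀ v, ∃ w, G.IsRightEdge v w := hG
  have hne : ∀ U : G.ProjVertex, U.1.Nonempty := by
    rintro ⟨U, hU⟩
    obtain ⟨v, rfl⟩ := (hG.isProjVertex_iff U).1 hU
    exact hG' v
  choose ν hν using hne
  -- The partner of a class consists of the vertices joined to it by a right edge.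
  let σ : G.ProjVertex → G.ProjVertex := fun U =>
    ⟨{x | G.IsRightEdge (ν U) x}, (hG.isProjVertex_iff _).2 ⟨_, rfl⟩⟩
  have hmem : ∀ (U : G.ProjVertex) (u : V), u ∈ U.1 → ∀ x, x ∈ (σ U).1 ↔ G.IsRightEdge u x := by
    rintro U u hu x
    obtain ⟨w, hw⟩ := (hG.isProjVertex_iff U.1).1 U.2
    have h1 : G.IsRightEdge w u := by rw [hw] at hu; exact hu
    have h2 : G.IsRightEdge w (ν U) := by have := hν U; rw [hw] at this; exact this
    exact ⟨fun h => h1.symm.trans h2 h, fun h => h2.symm.trans h1 h⟩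
  have hadj : ∀ (U : G.ProjVertex) (u x : V), u ∈ U.1 → x ∈ (σ U).1 → G.IsRightEdge u x :=
    fun U u x hu hx => (hmem U u hu x).1 hx
  have hinv : ∀ U, σ (σ U) = U := by
    intro U
    obtain ⟨w, hw⟩ := (hG.isProjVertex_iff U.1).1 U.2
    have h1 : G.IsRightEdge w (ν U) := by have := hν U; rw [hw] at this; exact this
    refine Subtype.ext (Set.ext fun x => ?_)
    rw [hmem (σ U) w ((hmem U _ (hν U) w).2 h1.symm) x, hw]
    rfl
  -- One edge between two classes forces all of them: an endpoint may be moved within its class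
  -- through a common right neighbour.
  have hrep : ∀ (U U' : G.ProjVertex), G.proj.Adj U U' → ∀ u ∈ U.1, ∀ u' ∈ U'.1, G.Adj u u' := by
    have key : ∀ (U U' : G.ProjVertex), G.proj.Adj U U' →
        ∀ u ∈ U.1, ∃ u' ∈ U'.1, G.Adj u u' := by
      rintro U U' ⟨x, hx, x', hx', hxx'⟩ u hu
      obtain ⟨b, hb⟩ := hG' x
      have hub := hadj U u b hu ((hmem U x hx b).2 hb)
      exact ⟨x', hx', (hb.2 x' u hxx' hub.1.symm).symm⟩
    intro U U' h u hu u' hu'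
    obtain ⟨y', hy', huy⟩ := key U U' h u hu
    obtain ⟨b, hb⟩ := hG' y'
    have hub := hadj U' u' b hu' ((hmem U' y' hy' b).2 hb)
    exact hb.2 u u' huy.symm hub.1.symm
  refine ⟨σ, hinv, fun U => ⟨ν U, hν U, ν (σ U), hν _, (hadj U _ _ (hν U) (hν _)).1⟩, ?_, ?_⟩
  · intro X U W hXU hXW
    refine ⟨ν U, hν U, ν W, hν W, ?_⟩
    exact (hadj X (ν X) (ν (σ X)) (hν _) (hν _)).2 _ _ (hrep _ _ hXU _ (hν _) _ (hν _))
      (hrep _ _ hXW _ (hν _) _ (hν _))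
  · intro X Y hXY hYX
    have hab := hadj X (ν X) (ν (σ X)) (hν _) (hν _)
    have hcd := hadj Y (ν Y) (ν (σ Y)) (hν _) (hν _)
    have had := hrep _ _ hXY _ (hν _) _ (hν _)
    have hcb := hrep _ _ hYX _ (hν _) _ (hν _)
    -- The two adjacencies combine the squares at `X` and `Y` into a new right edge, so `X` and `Y`
    -- have the same partner.
    have hright : G.IsRightEdge (ν X) (ν (σ Y)) := by
      refine ⟨had, fun u w hu hw => ?_⟩
      have huc : G.Adj u (ν Y) := hab.2 u _ hu hcb.symm
      exact hcd.2 u w huc.symm hw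
    have : σ X = σ Y := by
      refine Subtype.ext ?_
      exact setOf_isRightEdge_eq hright hcd
    rw [← hinv X, this, hinv]

end SimpleGraph

/-- `G` is a finite simple graph with the weak square condition; `K` is an arbitrary field, in an
arbitrary universe. -/
theorem theorem4p7 {V : Type*} [Finite V] (G : SimpleGraph V) (hG : G.WeakSquareCondition) :
    ∀ (K : Type*) [Field K],
      (MvPolynomial.idealComplex (G.proj.edgeIdeal K)).IsShellable ∧
      G.proj.IsCohenMacaulayOver K := by
  intro K _
  obtain ⟨σ, hσ⟩ := hG.exists_isRightPairing_proj
  exact ⟨hσ.isShellable, hσ.isCohenMacaulayOver K⟩
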